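/- For integers $n,k\ge 1$ let $\mathcal K_k^n$ be the family of the $k^n$ closed cubes $\prod_{s=1}^n\left[\frac{i_s-1}{k},\frac{i_s}{k}\right]$, $i_s\in\{1,\dots,k\}$, into which $I^n=[0,1]^n$ is divided. A set $S\subset I^n$ connects some opposite faces of $I^n$ if $S$ is connected and, for some $i\in\{1,\dots,n\}$, contains a point with $i$th coordinate $0$ and a point with $i$th coordinate $1$. A set $P\subset\mathbb Z^{n-1}$ is $1$-connected if any two of its points can be joined by a finite sequence of points of $P$ whose consecutive terms are at $\ell^\infty$-distance at most $1$. For $0\le m\le n-1$ let $\widehat C_{n,m}$ denote the minimum of the real constants $C>0$ with the following property: for every integer $k\ge1$ and every $F\colon\mathcal K_k^n\to\mathbb Z^{n-1}$ such that $\|F(K_1)-F(K_2)\|_\infty\le 1$ whenever $\dim(K_1\cap K_2)\ge m$ (topological dimension), there exist a $1$-connected set $P\subset\mathbb Z^{n-1}$ with $|P|\le C$ and a family $\mathcal S\subset F^{-1}[P]$ such that $\bigcup\mathcal S$ connects some opposite faces of $I^n$. **Proposition.** In dimension $2$ these minima exist and $\widehat C_{2,0}=\widehat C_{2,1}=1$.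 In particular, for every $k\ge 1$ and every integer-valued coloring $F$ of the $k\times k$ squares of $\mathcal K_k^2$ in which the values on any two squares sharing an edge differ by at most $1$, there are a value $p\in\mathbb Z$ and a family $\mathcal S\subset F^{-1}[\{p\}]$ of squares such that $\bigcup\mathcal S$ connects some opposite sides of $I^2$. -/

import Mathlib

/-- The cube of side length `1 / k` with (zero-based) index `i` in the division of the unit cube
`[0, 1]ⁿ` into `kⁿ` cubes. -/
def gridCube (n k : ℕ) (i : Fin n → Fin k) : Set (Fin n → ℝ) :=
  {x | ∀ s, ((i s : ℕ) : ℝ) / (k : ℝ) ≤ x s ∧ x s ≤ (((i s : ℕ) : ℝ) + 1) / (k : ℝ)}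

/-- The family of the `kⁿ` cubes into which `[0, 1]ⁿ` is divided. -/
def cubeFamily (n k : ℕ) : Set (Set (Fin n → ℝ)) :=
  Set.range (gridCube n k)

/-- `S ⊆ [0, 1]ⁿ` is connected and meets both faces `{z s = 0}` and `{z s = 1}` of the unit cube. -/
def ConnectsOppositeFaces (n : ℕ) (s : Fin n) (S : Set (Fin n → ℝ)) : Prop :=
  S ⊆ Set.Icc 0 1 ∧ IsConnected S ∧ (∃ z ∈ S, z s = 0) ∧ (∃ z ∈ S, z s = 1)

/-- `S` connects the `s`-th opposite faces of `[0, 1]ⁿ` for some `s`. -/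
def ConnectsSomeOppositeFaces (n : ℕ) (S : Set (Fin n → ℝ)) : Prop :=
  ∃ s : Fin n, ConnectsOppositeFaces n s S

/-- `S` is `r`-connected: any two of its points are joined by a finite sequence of points of `S`
whose consecutive members are at distance at most `r`. -/
def IsRConnected {X : Type*} [MetricSpace X] (r : ℝ) (S : Set X) : Prop :=
  ∀ x ∈ S, ∀ y ∈ S, ∃ (N : ℕ) (p : Fin (N + 1) → X),
    (∀ j, p j ∈ S) ∧ p 0 = x ∧ p (Fin.last N) = y ∧
      ∀ j : Fin N, dist (p j.castSucc) (p j.succ) ≤ r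

/-- The property of a constant `C`: for every `k ≥ 1` and every `F` from the cubes to `ℤⁿ⁻¹`
whose values on cubes meeting in dimension at least `m` are at `ℓ^∞`-distance at most `1`, there
are a `1`-connected set `P` of at most `C` lattice points and a family of cubes with values in `P`
whose union connects some opposite faces. -/
def HasConnectingProperty (n m : ℕ) (C : ℝ) : Prop :=
  ∀ k : ℕ, 1 ≤ k → ∀ F : cubeFamily n k → (Fin (n - 1) → ℤ),
    (∀ K₁ K₂ : cubeFamily n k,
      (m : WithBot ℕ∞) ≤
          smallInductiveDimension ((K₁ : Set (Fin n → ℝ)) ∩ (K₂ : Set (Fin n → ℝ)) : Set _) →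
        ‖F K₁ - F K₂‖ ≤ 1) →
    ∃ P : Set (Fin (n - 1) → ℤ), IsRConnected 1 P ∧ P.Finite ∧ (P.ncard : ℝ) ≤ C ∧
      ∃ 𝒮 : Set (cubeFamily n k), 𝒮 ⊆ F ⁻¹' P ∧
        ConnectsSomeOppositeFaces n (⋃ K ∈ 𝒮, (K : Set (Fin n → ℝ)))

/-- `c` is the minimum constant `C > 0` with the connecting property for `(n, m)`. -/
def IsOptimalConstant (n m : ℕ) (c : ℝ) : Prop :=
  IsLeast {C : ℝ | 0 < C ∧ HasConnectingProperty n m C} c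

/-! Split the level sets of the coloring into components, diagonal contact allowed, and suppose none
joins opposite sides. On the bottom side take the last point whose component `C` reaches the left
side; let `D` be the component of the next point. Count modulo 2 the edges between `C` and `D`. Slow
variation makes this count vanish around every unit face (`crossing_face`), so it is the difference
of a potential, constant on each component. From a point of `C` on the left side go clockwise along
the boundary to the chosen point: `D` misses the left side, `C` misses the top, the right and the
rest of the bottom, so only the last edge counts. The potential changes by 1 between two points of
`C`, a contradiction. The constant 1 thus works for edge-adjacency, hence for the stronger
hypothesis `m = 0`; no smaller constant works, since `P` is nonempty. -/

/-! ### Crossings modulo 2 -/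

/-- The number modulo two of crossings between `C` and `D` on an edge from `x` to `y`. -/
noncomputable def crossing {Q : Type*} (C D x y : Q) : ZMod 2 :=
  open Classical in if (x = C ∧ y = D) ∨ (x = D ∧ y = C) then 1 else 0

section Crossing

variable {Q : Type*} {C D : Q}

theorem crossing_comm (x y : Q) : crossing C D x y = crossing C D y x := by
  unfold crossing
  congr 1
  simp only [eq_iff_iff]
  tauto

theorem crossing_self (hCD : C ≠ D) (x : Q) : crossing C D x x = 0 := by
  unfold crossing
  rw [if_neg]
  rintro (⟨rfl, h⟩ | ⟨rfl, h⟩)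
  · exact hCD h
  · exact hCD h.symm

theorem crossing_left_right : crossing C D C D = 1 := by
  simp [crossing]

theorem crossing_eq_zero_of_ne_left {x y : Q} (hx : x ≠ C) (hy : y ≠ C) :
    crossing C D x y = 0 := by
  simp [crossing, hx, hy]

theorem crossing_eq_zero_of_ne_right {x y : Q} (hx : x ≠ D) (hy : y ≠ D) :
    crossing C D x y = 0 := by
  simp [crossing, hx, hy]

theorem crossing_add_crossing_swap (x y : Q) : crossing C D x y + crossing C D y x = 0 := by
  rw [crossing_comm y x, CharTwo.add_self_eq_zero]

/-- Around a unit face with a labelling refining an integer function that varies slowly and on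
which equal values have equal labels, the crossings cancel. -/
theorem crossing_face (hCD : C ≠ D) {g : Q → ℤ} {a b c d : Q}
    (hab : |g b - g a| ≤ 1) (hbd : |g d - g b| ≤ 1) (hac : |g c - g a| ≤ 1)
    (hcd : |g d - g c| ≤ 1) (eab : g a = g b → a = b) (ebd : g b = g d → b = d)
    (eac : g a = g c → a = c) (ecd : g c = g d → c = d) (ead : g a = g d → a = d)
    (ebc : g b = g c → b = c) :
    crossing C D a b + crossing C D b d = crossing C D a c + crossing C D c d := by
  by_cases had : g a = g d
  · obtain rfl := ead had
    rw [crossing_add_crossing_swap, crossing_add_crossing_swap]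
  by_cases hbc : g b = g c
  · rw [ebc hbc]
  rw [abs_le] at hab hbd hac hcd
  -- If `g a` and `g d` differed by 2, both `g b` and `g c` would be their midpoint; so they differ
  -- by 1, and `b`, `c` take one value each.
  have key : (g a = g b ∧ g c = g d) ∨ (g b = g d ∧ g a = g c) := by omega
  rcases key with ⟨h₁, h₂⟩ | ⟨h₁, h₂⟩
  · obtain rfl := eab h₁
    obtain rfl := ecd h₂
    simp [crossing_self hCD]
  · obtain rfl := ebd h₁
    obtain rfl := eac h₂
    simp [crossing_self hCD]

end Crossing

/-! ### Level components and the crossing potential -/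

/-- Two lattice points at `ℓ^∞`-distance at most one at which `G` takes the same value. -/
def LevelStep (G : ℕ → ℕ → ℤ) (x y : ℕ × ℕ) : Prop :=
  x.1 ≤ y.1 + 1 ∧ y.1 ≤ x.1 + 1 ∧ x.2 ≤ y.2 + 1 ∧ y.2 ≤ x.2 + 1 ∧ G x.1 x.2 = G y.1 y.2

theorem LevelStep.symm {G : ℕ → ℕ → ℤ} {x y : ℕ × ℕ} (h : LevelStep G x y) : LevelStep G y x :=
  ⟨h.2.1, h.1, h.2.2.2.1, h.2.2.1, h.2.2.2.2.symm⟩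

/-- The components of the level sets of `G`. -/
def LevelComponent (G : ℕ → ℕ → ℤ) : Type := Quot (LevelStep G)

/-- The component of a lattice point in its level set. -/
def levelComponent (G : ℕ → ℕ → ℤ) (i j : ℕ) : LevelComponent G := Quot.mk _ (i, j)

/-- The value of `G` on a component of a level set. -/
def LevelComponent.value {G : ℕ → ℕ → ℤ} (q : LevelComponent G) : ℤ :=
  Quot.lift (fun x : ℕ × ℕ => G x.1 x.2) (fun _ _ h => h.2.2.2.2) q

theorem reflTransGen_of_levelComponent_eq {G : ℕ → ℕ → ℤ} {i j i' j' : ℕ}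
    (h : levelComponent G i j = levelComponent G i' j') :
    Relation.ReflTransGen (LevelStep G) (i, j) (i', j') := by
  have : Std.Symm (LevelStep G) := ⟨fun _ _ h => h.symm⟩
  have hgen := Quot.eqvGen_exact h
  generalize (i, j) = x at hgen
  generalize (i', j') = y at hgen
  induction hgen with
  | rel x y h => exact .single h
  | refl x => exact .refl
  | symm x y _ ih => exact symm_of _ ih
  | trans x y z _ _ h₁ h₂ => exact h₁.trans h₂

/-- A potential whose differences along edges are the crossings between `C` and `D`. -/
noncomputable def crossingPotential (G : ℕ → ℕ → ℤ) (C D : LevelComponent G) (i j : ℕ) : ZMod 2 :=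
  ∑ a ∈ Finset.range i, crossing C D (levelComponent G a 0) (levelComponent G (a + 1) 0) +
    ∑ b ∈ Finset.range j, crossing C D (levelComponent G i b) (levelComponent G i (b + 1))

section Potential

variable {G : ℕ → ℕ → ℤ} {C D : LevelComponent G}

theorem crossingPotential_succ_right (i j : ℕ) :
    crossingPotential G C D i (j + 1) = crossingPotential G C D i j +
      crossing C D (levelComponent G i j) (levelComponent G i (j + 1)) := by
  simp only [crossingPotential, Finset.sum_range_succ, add_assoc]

/-- Path independence: the potential is summed along the bottom row and then upwards, and each face
lifts the identity by one row. -/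
theorem crossingPotential_succ_left (hCD : C ≠ D) (hG₁ : ∀ i j, |G (i + 1) j - G i j| ≤ 1)
    (hG₂ : ∀ i j, |G i (j + 1) - G i j| ≤ 1) (i j : ℕ) :
    crossingPotential G C D (i + 1) j = crossingPotential G C D i j +
      crossing C D (levelComponent G i j) (levelComponent G (i + 1) j) := by
  induction j with
  | zero => simp [crossingPotential, Finset.sum_range_succ]
  | succ j ih =>
    rw [crossingPotential_succ_right, ih, crossingPotential_succ_right, add_assoc, add_assoc]
    congr 1
    refine crossing_face (g := LevelComponent.value) hCD (hG₁ i j) (hG₂ (i + 1) j) (hG₂ i j)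
      (hG₁ i (j + 1)) ?_ ?_ ?_ ?_ ?_ ?_ <;>
    · intro h
      apply Quot.sound
      refine ⟨?_, ?_, ?_, ?_, h⟩ <;> simp only <;> omega

/-- On a diagonal step, the two edges through an intermediate corner have equal crossings, which
cancel modulo 2. -/
theorem crossingPotential_eq_of_levelStep (hCD : C ≠ D) (hG₁ : ∀ i j, |G (i + 1) j - G i j| ≤ 1)
    (hG₂ : ∀ i j, |G i (j + 1) - G i j| ≤ 1) {x y : ℕ × ℕ} (h : LevelStep G x y) :
    crossingPotential G C D x.1 x.2 = crossingPotential G C D y.1 y.2 := by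
  have hl := crossingPotential_succ_left hCD hG₁ hG₂
  have hr := @crossingPotential_succ_right G C D
  have hdiag : ∀ i j, levelComponent G i j = levelComponent G (i + 1) (j + 1) →
      crossingPotential G C D i j = crossingPotential G C D (i + 1) (j + 1) := fun i j e => by
    rw [hl, hr, add_assoc, e, ← e, crossing_add_crossing_swap, add_zero]
  have hanti : ∀ i j, levelComponent G (i + 1) j = levelComponent G i (j + 1) →
      crossingPotential G C D (i + 1) j = crossingPotential G C D i (j + 1) := fun i j e => by
    rw [hl, hr, e]
  have hhor : ∀ i j, levelComponent G i j = levelComponent G (i + 1) j →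
      crossingPotential G C D i j = crossingPotential G C D (i + 1) j := fun i j e => by
    rw [hl, e, crossing_self hCD, add_zero]
  have hver : ∀ i j, levelComponent G i j = levelComponent G i (j + 1) →
      crossingPotential G C D i j = crossingPotential G C D i (j + 1) := fun i j e => by
    rw [hr, e, crossing_self hCD, add_zero]
  have e : levelComponent G x.1 x.2 = levelComponent G y.1 y.2 := Quot.sound h
  obtain ⟨a, b⟩ := x
  obtain ⟨c, d⟩ := y
  obtain ⟨h₁, h₂, h₃, h₄, -⟩ := h
  simp only at h₁ h₂ h₃ h₄ e ⊢
  obtain rfl | rfl | rfl : a = c ∨ a = c + 1 ∨ c = a + 1 := by omega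
  all_goals obtain rfl | rfl | rfl : b = d ∨ b = d + 1 ∨ d = b + 1 := by omega
  · rfl
  · exact (hver _ _ e.symm).symm
  · exact hver _ _ e
  · exact (hhor _ _ e.symm).symm
  · exact (hdiag _ _ e.symm).symm
  · exact hanti _ _ e
  · exact hhor _ _ e
  · exact (hanti _ _ e.symm).symm
  · exact hdiag _ _ e

theorem crossingPotential_eq_of_levelComponent_eq (hCD : C ≠ D)
    (hG₁ : ∀ i j, |G (i + 1) j - G i j| ≤ 1) (hG₂ : ∀ i j, |G i (j + 1) - G i j| ≤ 1)
    {i j i' j' : ℕ} (h : levelComponent G i j = levelComponent G i' j') :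
    crossingPotential G C D i j = crossingPotential G C D i' j' := by
  have key : ∀ y, Relation.ReflTransGen (LevelStep G) (i, j) y →
      crossingPotential G C D i j = crossingPotential G C D y.1 y.2 := fun y hy => by
    induction hy with
    | refl => rfl
    | tail _ h ih => exact ih.trans (crossingPotential_eq_of_levelStep hCD hG₁ hG₂ h)
  exact key _ (reflTransGen_of_levelComponent_eq h)

end Potential

/-! ### The boundary argument -/

theorem eq_of_forall_succ_eq {α : Type*} {f : ℕ → α} {m n : ℕ} (hmn : m ≤ n)
    (h : ∀ a, m ≤ a → a < n → f (a + 1) = f a) : f n = f m := by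
  induction n, hmn using Nat.le_induction with
  | base => rfl
  | succ n hmn ih =>
    rw [h n hmn n.lt_succ_self, ih fun a ha han => h a ha (han.trans n.lt_succ_self)]

/-- Some component of a level set of a slowly varying integer function meets two opposite sides of
a lattice square. -/
theorem exists_levelComponent_connecting {G : ℕ → ℕ → ℤ} (hG₁ : ∀ i j, |G (i + 1) j - G i j| ≤ 1)
    (hG₂ : ∀ i j, |G i (j + 1) - G i j| ≤ 1) (n : ℕ) :
    (∃ j ≤ n, ∃ j' ≤ n, levelComponent G 0 j = levelComponent G n j') ∨
      ∃ i ≤ n, ∃ i' ≤ n, levelComponent G i 0 = levelComponent G i' n := by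
  classical
  by_contra! ⟨hLR, hBT⟩
  let p : ℕ → Prop := fun i => ∃ j ≤ n, levelComponent G 0 j = levelComponent G i 0
  have hp0 : p 0 := ⟨0, n.zero_le, rfl⟩
  set i := Nat.findGreatest p n with hi
  obtain ⟨j, hj, hij⟩ : p i := Nat.findGreatest_spec n.zero_le hp0
  have hin : i < n := lt_of_le_of_ne (Nat.findGreatest_le n) fun h =>
    hLR j hj 0 n.zero_le (by rw [hij, h])
  have hmax : ∀ a, i < a → a ≤ n → ¬ p a := fun a => Nat.findGreatest_is_greatest
  set C := levelComponent G i 0 with hC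
  set D := levelComponent G (i + 1) 0 with hD
  have hDL : ∀ b ≤ n, levelComponent G 0 b ≠ D := fun b hb h =>
    hmax (i + 1) i.lt_succ_self hin ⟨b, hb, h⟩
  have hCD : C ≠ D := hij ▸ hDL j hj
  have hl := crossingPotential_succ_left hCD hG₁ hG₂
  have hr := @crossingPotential_succ_right G C D
  have hL : ∀ b ≤ n, crossingPotential G C D 0 b = crossingPotential G C D 0 0 := fun b hb =>
    eq_of_forall_succ_eq b.zero_le fun a _ ha => by
      rw [hr, crossing_eq_zero_of_ne_right (hDL _ (by omega)) (hDL _ (by omega)), add_zero]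
  have hCT : ∀ a ≤ n, levelComponent G a n ≠ C := fun a ha h => hBT i hin.le a ha h.symm
  have hT : crossingPotential G C D n n = crossingPotential G C D 0 n :=
    eq_of_forall_succ_eq (f := fun a => crossingPotential G C D a n) n.zero_le fun a _ ha => by
      rw [hl, crossing_eq_zero_of_ne_left (hCT _ (by omega)) (hCT _ (by omega)), add_zero]
  have hCR : ∀ b ≤ n, levelComponent G n b ≠ C := fun b hb h => hLR j hj b hb (hij.trans h.symm)
  have hR : crossingPotential G C D n n = crossingPotential G C D n 0 :=
    eq_of_forall_succ_eq n.zero_le fun b _ hb => by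
      rw [hr, crossing_eq_zero_of_ne_left (hCR _ (by omega)) (hCR _ (by omega)), add_zero]
  have hCB : ∀ a, i < a → a ≤ n → levelComponent G a 0 ≠ C := fun a hia han h =>
    hmax a hia han ⟨j, hj, hij.trans h.symm⟩
  have hB : crossingPotential G C D n 0 = crossingPotential G C D (i + 1) 0 :=
    eq_of_forall_succ_eq (f := fun a => crossingPotential G C D a 0) hin fun a hia ha => by
      rw [hl, crossing_eq_zero_of_ne_left (hCB _ (by omega) (by omega))
        (hCB _ (by omega) (by omega)), add_zero]
  have hstep : crossingPotential G C D (i + 1) 0 = crossingPotential G C D i 0 + 1 := by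
    rw [hl, ← hC, ← hD, crossing_left_right]
  have hCL : crossingPotential G C D 0 j = crossingPotential G C D i 0 :=
    crossingPotential_eq_of_levelComponent_eq hCD hG₁ hG₂ hij
  -- This closes the loop: `hCL` is the return from the left side to `(i, 0)` inside `C`.
  have : crossingPotential G C D i 0 = crossingPotential G C D i 0 + 1 := by
    rw [← hstep, ← hB, ← hR, hT, hL n le_rfl, ← hL j hj, hCL]
  simp at this

/-! ### Geometry and dimension of grid cubes -/

theorem gridCube_eq_Icc {n k : ℕ} (i : Fin n → Fin k) :
    gridCube n k i =
      Set.Icc (fun s => ((i s : ℕ) : ℝ) / k) (fun s => (((i s : ℕ) : ℝ) + 1) / k) := by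
  ext x
  simp only [gridCube, Set.mem_ofPred_eq, Set.mem_Icc, Pi.le_def, forall_and]

theorem convex_gridCube {n k : ℕ} (i : Fin n → Fin k) : Convex ℝ (gridCube n k i) := by
  rw [gridCube_eq_Icc]
  exact convex_Icc _ _

theorem corner_mem_gridCube {n k : ℕ} (i : Fin n → Fin k) :
    (fun s => ((i s : ℕ) : ℝ) / k) ∈ gridCube n k i := fun s =>
  ⟨le_rfl, by simp only; gcongr; simp⟩

theorem opposite_corner_mem_gridCube {n k : ℕ} (i : Fin n → Fin k) :
    (fun s => (((i s : ℕ) : ℝ) + 1) / k) ∈ gridCube n k i := fun s =>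
  ⟨by simp only; gcongr; simp, le_rfl⟩

theorem isConnected_gridCube {n k : ℕ} (i : Fin n → Fin k) : IsConnected (gridCube n k i) :=
  ⟨⟨_, corner_mem_gridCube i⟩, (convex_gridCube i).isPreconnected⟩

theorem gridCube_subset_Icc {n k : ℕ} (i : Fin n → Fin k) : gridCube n k i ⊆ Set.Icc 0 1 := by
  refine fun x hx => ⟨fun s => le_trans (by positivity) (hx s).1, fun s => (hx s).2.trans ?_⟩
  have hk : (0 : ℝ) < k := by exact_mod_cast (i s).pos
  rw [Pi.one_apply, div_le_one hk]
  exact_mod_cast (i s).isLt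

/-- The point is symmetric in `i` and `j`, so for neighbouring cubes it lies in both. -/
theorem max_corner_mem_gridCube {n k : ℕ} {i j : Fin n → Fin k}
    (h : ∀ s, (j s : ℕ) ≤ i s + 1) :
    (fun s => ((max (i s : ℕ) (j s) : ℕ) : ℝ) / k) ∈ gridCube n k i := fun s => by
  refine ⟨by simp only; gcongr; exact le_max_left _ _, ?_⟩
  simp only
  gcongr
  exact_mod_cast max_le (Nat.le_succ _) (h s)

theorem gridCube_inter_nonempty {n k : ℕ} {i j : Fin n → Fin k}
    (hij : ∀ s, (i s : ℕ) ≤ j s + 1) (hji : ∀ s, (j s : ℕ) ≤ i s + 1) :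
    (gridCube n k i ∩ gridCube n k j).Nonempty := by
  refine ⟨_, max_corner_mem_gridCube hji, ?_⟩
  simp only [max_comm (i _ : ℕ)]
  exact max_corner_mem_gridCube hij

theorem gridCube_inter_nontrivial {n k : ℕ} {i j : Fin n → Fin k}
    (hij : ∀ s, (i s : ℕ) ≤ j s + 1) (hji : ∀ s, (j s : ℕ) ≤ i s + 1) {s : Fin n}
    (hs : i s = j s) : (gridCube n k i ∩ gridCube n k j).Nontrivial := by
  obtain ⟨x, hx⟩ := gridCube_inter_nonempty hij hji
  have hk : (0 : ℝ) < k := by exact_mod_cast (i s).pos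
  have hupd : ∀ t, ((i s : ℕ) : ℝ) / k ≤ t → t ≤ (((i s : ℕ) : ℝ) + 1) / k →
      Function.update x s t ∈ gridCube n k i ∩ gridCube n k j := fun t ht ht' => by
    constructor <;> intro r <;> obtain rfl | hr := eq_or_ne r s
    · simpa using ⟨ht, ht'⟩
    · simpa [hr] using hx.1 r
    · simpa [← hs] using ⟨ht, ht'⟩
    · simpa [hr] using hx.2 r
  have hlt : ((i s : ℕ) : ℝ) / k < (((i s : ℕ) : ℝ) + 1) / k := by
    gcongr
    simp
  refine ⟨_, hupd _ le_rfl hlt.le, _, hupd _ hlt.le le_rfl, fun h => hlt.ne ?_⟩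
  simpa using congrFun h s

/-- Dimension below 1 gives a basis of clopen sets, but connectedness leaves no clopen set
containing one point and missing another. -/
theorem one_le_smallInductiveDimension {X : Type*} [TopologicalSpace X] [T1Space X]
    [PreconnectedSpace X] [Nontrivial X] : 1 ≤ smallInductiveDimension X := by
  by_contra! h
  have hb := hasSmallInductiveDimensionLT_one_iff.1
    (smallInductiveDimension_lt_iff.1 (by simpa using h : smallInductiveDimension X < (1 : ℕ)))
  obtain ⟨x, y, hxy⟩ := exists_pair_ne X
  obtain ⟨U, hU, hxU, hUy⟩ :=
    hb.exists_subset_of_mem_open (Set.mem_compl_singleton_iff.2 hxy) isOpen_compl_singleton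
  have := hU.eq_univ ⟨x, hxU⟩
  exact hUy (this ▸ Set.mem_univ y) rfl

theorem one_le_smallInductiveDimension_gridCube_inter {n k : ℕ} {i j : Fin n → Fin k}
    (hij : ∀ s, (i s : ℕ) ≤ j s + 1) (hji : ∀ s, (j s : ℕ) ≤ i s + 1) {s : Fin n}
    (hs : i s = j s) :
    1 ≤ smallInductiveDimension (gridCube n k i ∩ gridCube n k j : Set (Fin n → ℝ)) := by
  have := (gridCube_inter_nontrivial hij hji hs).coe_sort
  have := isPreconnected_iff_preconnectedSpace.1
    ((convex_gridCube i).inter (convex_gridCube j)).isPreconnected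
  exact one_le_smallInductiveDimension

/-! ### From lattice components to unions of squares -/

/-- The index in the `(n + 1) × (n + 1)` grid nearest to a lattice point. -/
def clampIndex (n : ℕ) (x : ℕ × ℕ) : Fin 2 → Fin (n + 1) :=
  ![⟨min x.1 n, by omega⟩, ⟨min x.2 n, by omega⟩]

theorem clampIndex_le_add_one {n : ℕ} {x y : ℕ × ℕ} (h₁ : x.1 ≤ y.1 + 1) (h₂ : x.2 ≤ y.2 + 1)
    (s : Fin 2) : (clampIndex n x s : ℕ) ≤ clampIndex n y s + 1 := by
  fin_cases s <;> simp [clampIndex] <;> omega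

/-- A component may leave the grid, but clamping is nonexpansive in each coordinate, so each step
still gives squares that meet, perhaps only at a corner. -/
theorem isConnected_biUnion_gridCube_levelComponent {n : ℕ} (F : (Fin 2 → Fin (n + 1)) → ℤ)
    (q : LevelComponent fun i j => F (clampIndex n (i, j))) :
    IsConnected (⋃ i ∈ clampIndex n '' {x | levelComponent _ x.1 x.2 = q},
      gridCube 2 (n + 1) i) := by
  refine IsConnected.biUnion_of_reflTransGen (Set.Nonempty.image _ ?_)
    (fun i _ => isConnected_gridCube i) ?_
  · induction q using Quot.ind with
    | mk x => exact ⟨x, rfl⟩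
  · rintro _ ⟨x, hx, rfl⟩ _ ⟨y, hy, rfl⟩
    have hx' : levelComponent _ x.1 x.2 = q := hx
    have hy' : levelComponent _ y.1 y.2 = q := hy
    have hxy := reflTransGen_of_levelComponent_eq (hx'.trans hy'.symm)
    clear hy hy'
    change Relation.ReflTransGen _ x y at hxy
    -- The induction must also record that the chain stays in `q`.
    refine And.left (b := levelComponent _ y.1 y.2 = q) ?_
    induction hxy with
    | refl => exact ⟨.refl, hx⟩
    | @tail z w _ h ih =>
      refine ⟨ih.1.tail ⟨?_, z, ih.2, rfl⟩, (Quot.sound h).symm.trans ih.2⟩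
      exact gridCube_inter_nonempty (clampIndex_le_add_one h.1 h.2.2.1)
        (clampIndex_le_add_one h.2.1 h.2.2.2.1)

theorem connectsOppositeFaces_of_mem {n k : ℕ} {T : Set (Fin n → Fin k)}
    (hT : IsConnected (⋃ i ∈ T, gridCube n k i)) {s : Fin n} {i j : Fin n → Fin k} (hi : i ∈ T)
    (hj : j ∈ T) (his : (i s : ℕ) = 0) (hjs : (j s : ℕ) + 1 = k) :
    ConnectsOppositeFaces n s (⋃ i ∈ T, gridCube n k i) := by
  refine ⟨Set.iUnion₂_subset fun i _ => gridCube_subset_Icc i, hT,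
    ⟨_, Set.mem_biUnion hi (corner_mem_gridCube i), by simp [his]⟩,
    ⟨_, Set.mem_biUnion hj (opposite_corner_mem_gridCube j), ?_⟩⟩
  have hk : (k : ℝ) ≠ 0 := by exact_mod_cast (i s).pos.ne'
  rw [div_eq_one_iff_eq hk]
  exact_mod_cast hjs

/-- Clamping sends a lattice edge to a single square or to two squares sharing an edge. -/
theorem abs_sub_clampIndex_le_one {n : ℕ} {F : (Fin 2 → Fin (n + 1)) → ℤ}
    (hF : ∀ i j : Fin 2 → Fin (n + 1),
      |((i 0 : ℕ) : ℤ) - ((j 0 : ℕ) : ℤ)| + |((i 1 : ℕ) : ℤ) - ((j 1 : ℕ) : ℤ)| = 1 →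
        |F i - F j| ≤ 1) {x y : ℕ × ℕ}
    (hxy : (y.1 = x.1 + 1 ∧ y.2 = x.2) ∨ (y.1 = x.1 ∧ y.2 = x.2 + 1)) :
    |F (clampIndex n y) - F (clampIndex n x)| ≤ 1 := by
  by_cases h : clampIndex n y = clampIndex n x
  · simp [h]
  · refine hF _ _ ?_
    have h' : ¬ (min y.1 n = min x.1 n ∧ min y.2 n = min x.2 n) := fun e => h (by
      simp [clampIndex, e.1, e.2])
    simp only [clampIndex, Matrix.cons_val_zero, Matrix.cons_val_one, Int.abs_eq_natAbs]
    omega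

/-- A slowly varying integer coloring of the squares of the `k × k` grid has a color class
containing a family of squares whose union connects opposite sides. -/
theorem exists_monochromatic_connecting {k : ℕ} (hk : 1 ≤ k) (F : (Fin 2 → Fin k) → ℤ)
    (hF : ∀ i j : Fin 2 → Fin k,
      |((i 0 : ℕ) : ℤ) - ((j 0 : ℕ) : ℤ)| + |((i 1 : ℕ) : ℤ) - ((j 1 : ℕ) : ℤ)| = 1 →
        |F i - F j| ≤ 1) :
    ∃ p : ℤ, ∃ T : Set (Fin 2 → Fin k), T ⊆ F ⁻¹' {p} ∧
      ConnectsSomeOppositeFaces 2 (⋃ i ∈ T, gridCube 2 k i) := by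
  obtain ⟨n, rfl⟩ := Nat.exists_eq_add_of_le' hk
  have hT := isConnected_biUnion_gridCube_levelComponent F
  have hval : ∀ q : LevelComponent fun i j => F (clampIndex n (i, j)),
      clampIndex n '' {x | levelComponent _ x.1 x.2 = q} ⊆ F ⁻¹' {q.value} := by
    rintro q _ ⟨x, rfl, rfl⟩
    rfl
  obtain ⟨j, -, j', -, h⟩ | ⟨i, -, i', -, h⟩ :=
    exists_levelComponent_connecting (G := fun i j => F (clampIndex n (i, j)))
      (fun i j => abs_sub_clampIndex_le_one hF (.inl ⟨rfl, rfl⟩))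
      (fun i j => abs_sub_clampIndex_le_one hF (.inr ⟨rfl, rfl⟩)) n
  · exact ⟨_, _, hval _, 0, connectsOppositeFaces_of_mem (hT _) ⟨(0, j), rfl, rfl⟩
      ⟨(n, j'), h.symm, rfl⟩ (by simp [clampIndex]) (by simp [clampIndex])⟩
  · exact ⟨_, _, hval _, 1, connectsOppositeFaces_of_mem (hT _) ⟨(i, 0), rfl, rfl⟩
      ⟨(i', n), h.symm, rfl⟩ (by simp [clampIndex]) (by simp [clampIndex])⟩

/-! ### The optimal constants -/

theorem isRConnected_singleton {X : Type*} [MetricSpace X] (r : ℝ) (x : X) :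
    IsRConnected r {x} := by
  rintro y rfl z hz
  exact ⟨0, fun _ => y, fun _ => rfl, rfl, hz.symm, fun j => j.elim0⟩

theorem hasConnectingProperty_two_one : HasConnectingProperty 2 1 1 := by
  intro k hk F hF
  let K : (Fin 2 → Fin k) → cubeFamily 2 k := fun i => ⟨gridCube 2 k i, i, rfl⟩
  obtain ⟨p, T, hT, hconn⟩ := exists_monochromatic_connecting hk (fun i => F (K i) 0)
    fun i j hij => by
      simp only [Int.abs_eq_natAbs] at hij
      have h₁ : ∀ s, (i s : ℕ) ≤ j s + 1 := by
        rw [Fin.forall_fin_two]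
        omega
      have h₂ : ∀ s, (j s : ℕ) ≤ i s + 1 := by
        rw [Fin.forall_fin_two]
        omega
      -- The common coordinate is free to vary in the intersection, which therefore has dimension at
      -- least 1.
      obtain ⟨s, hs⟩ : ∃ s, i s = j s := by
        rw [Fin.exists_fin_two, Fin.ext_iff, Fin.ext_iff]
        omega
      have h := (norm_le_pi_norm _ 0).trans
        (hF (K i) (K j) (one_le_smallInductiveDimension_gridCube_inter h₁ h₂ hs))
      rw [Pi.sub_apply, Int.norm_eq_abs] at h
      exact_mod_cast h
  refine ⟨{fun _ => p}, isRConnected_singleton _ _, Set.finite_singleton _, by simp, K '' T, ?_, ?_⟩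
  · rintro _ ⟨i, hi, rfl⟩
    refine funext fun s => ?_
    rw [Subsingleton.elim (α := Fin 1) s 0]
    exact hT hi
  · rwa [Set.biUnion_image]

/-- A smaller `m` constrains more pairs of cubes, so fewer colorings are admitted. -/
theorem HasConnectingProperty.anti {n m m' : ℕ} {C : ℝ} (hm : m ≤ m')
    (h : HasConnectingProperty n m' C) : HasConnectingProperty n m C :=
  fun k hk F hF => h k hk F fun K₁ K₂ hK => hF K₁ K₂ (le_trans (by exact_mod_cast hm) hK)

/-- Tested on a single cube: a connecting union is nonempty, so `P` has a point. -/
theorem HasConnectingProperty.one_le {n m : ℕ} {C : ℝ} (h : HasConnectingProperty n m C) :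
    1 ≤ C := by
  obtain ⟨P, -, hP, hC, 𝒮, h𝒮, -, -, hconn, -⟩ := h 1 le_rfl (fun _ => 0) (by simp)
  obtain ⟨x, hx⟩ := hconn.nonempty
  obtain ⟨K, hK, -⟩ := Set.mem_iUnion₂.1 hx
  have : 1 ≤ P.ncard := (Set.ncard_pos hP).2 ⟨_, h𝒮 hK⟩
  exact le_trans (by exact_mod_cast this) hC

theorem mainTheorem5 :
    IsOptimalConstant 2 0 1 ∧ IsOptimalConstant 2 1 1 ∧
    (∀ k : ℕ, 1 ≤ k → ∀ F : (Fin 2 → Fin k) → ℤ,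
      (∀ i j : Fin 2 → Fin k,
        |((i 0 : ℕ) : ℤ) - ((j 0 : ℕ) : ℤ)| + |((i 1 : ℕ) : ℤ) - ((j 1 : ℕ) : ℤ)| = 1 →
          |F i - F j| ≤ 1) →
      ∃ p : ℤ, ∃ T : Set (Fin 2 → Fin k), T ⊆ F ⁻¹' {p} ∧
        ConnectsSomeOppositeFaces 2 (⋃ i ∈ T, gridCube 2 k i)) := by
  exact ⟨⟨⟨one_pos, hasConnectingProperty_two_one.anti zero_le_one⟩, fun _ h => h.2.one_le⟩,
    ⟨⟨one_pos, hasConnectingProperty_two_one⟩, fun _ h => h.2.one_le⟩,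
    fun _ hk F hF => exists_monochromatic_connecting hk F hF⟩
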